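/- Let $(\mathcal H,[\cdot,\cdot])$ be a Krein space (the metric being conjugate-linear in its first argument) with a fixed canonical decomposition $\mathcal H=\mathcal H^-[\oplus]\mathcal H^+$, canonical projections $P^\pm$, canonical symmetry $J=P^+-P^-$, and norm $\|x\|=\sqrt{[x,Jx]}$. Put $I^\pm=I|_{\mathcal H^\pm}$. A (linear) relation is a linear subset of a product of two linear spaces; operators are identified with their graphs, and $\mathcal D_R$ denotes the domain of $R$. Sums, products, inverses and restrictions are those of linear relations. For a relation $R$ from $\mathcal E$ to $\mathcal F$, where each of $\mathcal E,\mathcal F$ is one of $\mathcal H,\mathcal H^+,\mathcal H^-$ with the metric $[\cdot,\cdot]$, the adjoint is $R^c=\{(v,w)\in\mathcal F\times\mathcal E : [x,w]=[y,v]\ \text{for all}\ (x,y)\in R\}$. Let $T$ be a self-adjoint relation in $\mathcal H$, i.e. $T=T^c$, with $\mathcal H^-\subseteq\mathcal D_T$. For $\lambda\in\mathbb C\setminus\mathbb R$ put $$T^{--}=P^-T|_{\mathcal H^-},\qquad \mathcal L_\lambda=(T-\lambda I)^{-1}(\mathcal H^+),\qquad \gamma_\lambda=P^-(P^+|_{\mathcal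 L_\lambda})^{-1},$$ $$\mathcal T^{\pm}(\lambda)=\{(P^\pm x,P^\pm y) : (x,y)\in T,\ y-\lambda x\in\mathcal H^\pm\},$$ so that $\gamma_\lambda$ is a relation from $\mathcal H^+$ to $\mathcal H^-$ and $\mathcal T^\pm(\lambda)$ is a relation in $\mathcal H^\pm$. Then for every $\lambda\in\mathbb C\setminus\mathbb R$: a) $\mathcal L_\lambda$ is of class $\mathcal A^+$, i.e. $\mathcal H^-\cap\mathcal L_\lambda=\{0\}$. The relation $\gamma_\lambda$ is a closable operator with $$\mathcal D_{\gamma_\lambda}=P^+(\mathcal L_\lambda)=\mathcal H^+\cap\mathcal D_T=\mathcal D_{\mathcal T^+(\lambda)},\qquad \mathcal D_{\gamma_\lambda^c}=\mathcal H^-,$$ and it is bounded. Moreover $\gamma_\lambda$ is a contraction ($\|\gamma_\lambda x\|\le\|x\|$ on $\mathcal D_{\gamma_\lambda}$) if and only if $\mathcal L_\lambda$ is non-negative ($[x,x]\ge0$ for all $x\in\mathcal L_\lambda$). b) As linear relations in $\mathcal H^-$, $$(\mathcal T^-(\lambda)-\lambda I^-)^{-1}=(T^{--}-\lambda I^-)^{-1}+\gamma_\lambda\,(\mathcal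 T^+(\lambda)-\lambda I^+)^{-1}\,\gamma_{\bar\lambda}^{\,c}.$$ -/

import Mathlib

open scoped InnerProductSpace ComplexConjugate

noncomputable section

/-! ## Linear relations

A relation from `E` to `F` is a lineal (linear subset) of `E × F`. Operators are identified
with their graphs; the graph of an everywhere defined operator is `LinearMap.graph`. -/

/-- A linear relation from `E` to `F`. -/
abbrev LinRel (E F : Type*) [AddCommGroup E] [Module ℂ E] [AddCommGroup F] [Module ℂ F] :=
  Submodule ℂ (E × F)

namespace LinRel

variable {E F G : Type*} [AddCommGroup E] [Module ℂ E] [AddCommGroup F] [Module ℂ F]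
  [AddCommGroup G] [Module ℂ G]

/-- The domain `{x | ∃ y, (x, y) ∈ R}`. -/
def dom (R : LinRel E F) : Submodule ℂ E := R.map (LinearMap.fst ℂ E F)

/-- The multivalued part (indefiniteness) `{y | (0, y) ∈ R}`. -/
def ind (R : LinRel E F) : Submodule ℂ F := R.comap (LinearMap.inr ℂ E F)

/-- A relation is (the graph of) an operator when its multivalued part is trivial. -/
def IsOperator (R : LinRel E F) : Prop := R.ind = ⊥

/-- The inverse relation `{(y, x) | (x, y) ∈ R}`. -/
def inv (R : LinRel E F) : LinRel F E where
  carrier := {p | (p.2, p.1) ∈ R}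
  add_mem' := fun ha hb => R.add_mem ha hb
  zero_mem' := R.zero_mem
  smul_mem' := fun c _ ha => R.smul_mem c ha

/-- The product `S R = {(x, z) | ∃ y, (x, y) ∈ R, (y, z) ∈ S}`. -/
def comp (S : LinRel F G) (R : LinRel E F) : LinRel E G where
  carrier := {p | ∃ y, (p.1, y) ∈ R ∧ (y, p.2) ∈ S}
  add_mem' := by
    rintro a b ⟨y, h1, h2⟩ ⟨y', h1', h2'⟩
    exact ⟨y + y', R.add_mem h1 h1', S.add_mem h2 h2'⟩
  zero_mem' := ⟨0, R.zero_mem, S.zero_mem⟩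
  smul_mem' := by
    rintro c a ⟨y, h1, h2⟩
    exact ⟨c • y, R.smul_mem c h1, S.smul_mem c h2⟩

/-- The operator-like sum `R + S = {(x, y + z) | (x, y) ∈ R, (x, z) ∈ S}`. -/
def opSum (R S : LinRel E F) : LinRel E F where
  carrier := {p | ∃ y z, (p.1, y) ∈ R ∧ (p.1, z) ∈ S ∧ p.2 = y + z}
  add_mem' := by
    rintro a b ⟨y, z, h1, h2, h3⟩ ⟨y', z', h1', h2', h3'⟩
    refine ⟨y + y', z + z', R.add_mem h1 h1', S.add_mem h2 h2', ?_⟩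
    rw [Prod.snd_add, h3, h3']
    abel
  zero_mem' := ⟨0, 0, R.zero_mem, S.zero_mem, by simp⟩
  smul_mem' := by
    rintro c a ⟨y, z, h1, h2, h3⟩
    refine ⟨c • y, c • z, R.smul_mem c h1, S.smul_mem c h2, ?_⟩
    rw [Prod.smul_snd, h3, smul_add]

/-- The relation `R - μ I = {(x, y - μ x) | (x, y) ∈ R}`. -/
def subSmulId (R : LinRel E E) (μ : ℂ) : LinRel E E where
  carrier := {p | ∃ y, (p.1, y) ∈ R ∧ p.2 = y - μ • p.1}
  add_mem' := by
    rintro a b ⟨y, h1, h2⟩ ⟨y', h1', h2'⟩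
    refine ⟨y + y', R.add_mem h1 h1', ?_⟩
    rw [Prod.snd_add, Prod.fst_add, h2, h2', smul_add]
    abel
  zero_mem' := ⟨0, R.zero_mem, by simp⟩
  smul_mem' := by
    rintro c a ⟨y, h1, h2⟩
    refine ⟨c • y, R.smul_mem c h1, ?_⟩
    rw [Prod.smul_snd, Prod.smul_fst, h2, smul_sub, smul_comm]

/-- The domain restriction `R|_L = {(x, y) ∈ R | x ∈ L}`. -/
def restrict (R : LinRel E F) (L : Submodule ℂ E) : LinRel E F :=
  R ⊓ L.comap (LinearMap.fst ℂ E F)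

/-- The image `R(L) = {y | ∃ x ∈ L, (x, y) ∈ R}`. -/
def image (R : LinRel E F) (L : Submodule ℂ E) : Submodule ℂ F :=
  (R.restrict L).map (LinearMap.snd ℂ E F)

/-- The adjoint of `R` with respect to sesquilinear forms (conjugate-linear in the first
argument) on `E` and `F`: all `(v, w) ∈ F × E` with `[x, w] = [y, v]` for every `(x, y) ∈ R`. -/
def formAdjoint (bE : E →ₗ⋆[ℂ] E →ₗ[ℂ] ℂ) (bF : F →ₗ⋆[ℂ] F →ₗ[ℂ] ℂ) (R : LinRel E F) :
    LinRel F E where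
  carrier := {p | ∀ x y, (x, y) ∈ R → bE x p.2 = bF y p.1}
  add_mem' := by
    intro a b ha hb x y h
    rw [Prod.snd_add, Prod.fst_add, map_add, map_add, ha x y h, hb x y h]
  zero_mem' := by
    intro x y _
    simp
  smul_mem' := by
    intro c a ha x y h
    rw [Prod.smul_snd, Prod.smul_fst, map_smul, map_smul, ha x y h]

end LinRel

namespace LinRel

variable {E F : Type*} [NormedAddCommGroup E] [InnerProductSpace ℂ E]
  [NormedAddCommGroup F] [InnerProductSpace ℂ F]

/-- The closure of `R` is an operator. -/
def IsClosable (R : LinRel E F) : Prop := IsOperator (Submodule.topologicalClosure R)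

/-- Boundedness on the domain: `‖y‖ ≤ C ‖x‖` for all `(x, y) ∈ R`, some constant `C`. -/
def IsBounded (R : LinRel E F) : Prop := ∃ C : ℝ, ∀ x y, (x, y) ∈ R → ‖y‖ ≤ C * ‖x‖

/-- Contractivity on the domain: `‖y‖ ≤ ‖x‖` for all `(x, y) ∈ R`. -/
def IsContraction (R : LinRel E F) : Prop := ∀ x y, (x, y) ∈ R → ‖y‖ ≤ ‖x‖

end LinRel

/-! ## Krein spaces -/

/-- A canonical symmetry of the Hilbert space `H`: a self-adjoint involution `J`. It makes `H`
a Krein space with indefinite metric `[x, y] = ⟪x, J y⟫` and canonical decomposition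
`H = H⁻ [⊕] H⁺`, where `H⁻` and `H⁺` are the eigenspaces of `J` for `-1` and `1`. Conversely, a
Krein space with a fixed canonical decomposition is of this form for the Hilbert metric
`⟪x, y⟫ = [x, J y]`, `J = P⁺ - P⁻`. -/
structure CanonicalSymmetry (H : Type*) [NormedAddCommGroup H] [InnerProductSpace ℂ H] where
  /-- The operator. -/
  J : H →L[ℂ] H
  symmetric : ∀ x y : H, ⟪J x, y⟫_ℂ = ⟪x, J y⟫_ℂ
  involutive : ∀ x : H, J (J x) = x

namespace CanonicalSymmetry

variable {H : Type*} [NormedAddCommGroup H] [InnerProductSpace ℂ H] (K : CanonicalSymmetry H)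

/-- The indefinite metric `[x, y] = ⟪x, J y⟫`. -/
def form : H →ₗ⋆[ℂ] H →ₗ[ℂ] ℂ := (innerₛₗ ℂ).compl₂ (K.J : H →ₗ[ℂ] H)

/-- The negative component `H⁻` of the canonical decomposition. -/
def Hminus : Submodule ℂ H where
  carrier := {x | K.J x = -x}
  add_mem' := by
    intro a b (ha : K.J a = -a) (hb : K.J b = -b)
    change K.J (a + b) = -(a + b)
    rw [map_add, ha, hb, neg_add]
  zero_mem' := by simp
  smul_mem' := by
    intro c a (ha : K.J a = -a)
    change K.J (c • a) = -(c • a)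
    rw [map_smul, ha, smul_neg]

/-- The positive component `H⁺` of the canonical decomposition. -/
def Hplus : Submodule ℂ H where
  carrier := {x | K.J x = x}
  add_mem' := by
    intro a b (ha : K.J a = a) (hb : K.J b = b)
    change K.J (a + b) = a + b
    rw [map_add, ha, hb]
  zero_mem' := by simp
  smul_mem' := by
    intro c a (ha : K.J a = a)
    change K.J (c • a) = c • a
    rw [map_smul, ha]

/-- The canonical projection `P⁻ = (I - J) / 2` onto `H⁻`. -/
def Pminus : H →ₗ[ℂ] K.Hminus :=
  LinearMap.codRestrict K.Hminus ((1 / 2 : ℂ) • (LinearMap.id - (K.J : H →ₗ[ℂ] H))) (by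
    intro x
    change K.J ((1 / 2 : ℂ) • (x - K.J x)) = -((1 / 2 : ℂ) • (x - K.J x))
    rw [map_smul, map_sub, K.involutive, ← smul_neg, neg_sub])

/-- The canonical projection `P⁺ = (I + J) / 2` onto `H⁺`. -/
def Pplus : H →ₗ[ℂ] K.Hplus :=
  LinearMap.codRestrict K.Hplus ((1 / 2 : ℂ) • (LinearMap.id + (K.J : H →ₗ[ℂ] H))) (by
    intro x
    change K.J ((1 / 2 : ℂ) • (x + K.J x)) = (1 / 2 : ℂ) • (x + K.J x)
    rw [map_smul, map_add, K.involutive, add_comm])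

/-- The restriction of the indefinite metric to a lineal. -/
def formOn (L : Submodule ℂ H) : L →ₗ⋆[ℂ] L →ₗ[ℂ] ℂ := K.form.domRestrict₁₂ L L

/-- The adjoint `Tᶜ` of a relation in `H` with respect to the indefinite metric: all `(u, v)`
with `[x, v] = [y, u]` for every `(x, y) ∈ T`. -/
def adj (T : LinRel H H) : LinRel H H := T.formAdjoint K.form K.form

/-- The relation `T` is self-adjoint in the Krein space. -/
def IsSelfAdj (T : LinRel H H) : Prop := T = K.adj T

/-- A lineal of class `A⁺`: it meets `H⁻` trivially. -/
def ClassAPlus (L : Submodule ℂ H) : Prop := K.Hminus ⊓ L = ⊥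

/-- A non-negative lineal: `[x, x] ≥ 0` on it (the number `[x, x]` is real). -/
def IsNonneg (L : Submodule ℂ H) : Prop := ∀ x ∈ L, 0 ≤ (K.form x x).re

/-- `T⁻⁻ = P⁻ T|_{H⁻}`, a relation in `H⁻`. -/
def Tmm (T : LinRel H H) : LinRel K.Hminus K.Hminus :=
  LinRel.comp (LinearMap.graph K.Pminus) (LinRel.comp T (LinearMap.graph K.Hminus.subtype))

/-- The relation `{(P⁻ x, P⁻ y) | (x, y) ∈ T, y - μ x ∈ H⁻}` in `H⁻`. -/
def Tminus (T : LinRel H H) (μ : ℂ) : LinRel K.Hminus K.Hminus :=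
  (T ⊓ K.Hminus.comap (LinearMap.snd ℂ H H - μ • LinearMap.fst ℂ H H)).map
    (K.Pminus.prodMap K.Pminus)

/-- The relation `{(P⁺ x, P⁺ y) | (x, y) ∈ T, y - μ x ∈ H⁺}` in `H⁺`. -/
def Tplus (T : LinRel H H) (μ : ℂ) : LinRel K.Hplus K.Hplus :=
  (T ⊓ K.Hplus.comap (LinearMap.snd ℂ H H - μ • LinearMap.fst ℂ H H)).map
    (K.Pplus.prodMap K.Pplus)

/-- The lineal `(T - μ I)⁻¹(H⁺)`. -/
def Llin (T : LinRel H H) (μ : ℂ) : Submodule ℂ H :=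
  (T.subSmulId μ).inv.image K.Hplus

/-- The relation `γ_μ = P⁻ (P⁺|_L)⁻¹` from `H⁺` to `H⁻`, with `L = (T - μ I)⁻¹(H⁺)`. -/
def gam (T : LinRel H H) (μ : ℂ) : LinRel K.Hplus K.Hminus :=
  LinRel.comp (LinearMap.graph K.Pminus)
    (LinRel.inv (LinRel.restrict (LinearMap.graph K.Pplus) (K.Llin T μ)))

/-- The adjoint of a relation from `H⁺` to `H⁻` with respect to the indefinite metrics that
`H⁺` and `H⁻` inherit from `H`; a relation from `H⁻` to `H⁺`. -/
def adjPM (R : LinRel K.Hplus K.Hminus) : LinRel K.Hminus K.Hplus :=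
  R.formAdjoint (K.formOn K.Hplus) (K.formOn K.Hminus)

end CanonicalSymmetry

end

/-! Everything rests on the compression `T⁻⁻`. Self-adjointness of `T` and `H⁻ ⊆ D_T` make it an
everywhere defined symmetric operator of the Hilbert space `H⁻`, so `T⁻⁻ - μ` is bijective for
non-real `μ` (`eq_zero_of_minus`, `exists_minus`). Hence any pair in `T` can be moved by a pair over
`H⁻`, so that its new `H⁻`-components satisfy `P⁻ y = μ P⁻ x`; this yields `D_γ = H⁺ ∩ D_T`, while
injectivity yields class `A⁺`.

For boundedness, `P⁻ T` is bounded by uniform boundedness, and `|Im μ|⁻¹` bounds the inverse of `T⁻⁻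
- μ`. Closability follows from the bound, and the contraction criterion from `[x, x] = ‖P⁺x‖² -
‖P⁻x‖²`.

For b), a pair over `x` defining an element of `𝒯⁻(μ)` is split as `(u, v) + (x - u, y - v)` with `u
∈ H⁻` solving the equation for `T⁻⁻ - μ`. The remainder has `x - u` in `(T - μ I)⁻¹(H⁺)`, and its
`H⁺`-source `-P⁺v` is a value of the adjoint of `γ` at `μ̄`, described by `mem_adjPM_gam_iff`. -/

/-- `μ - A` is onto for an everywhere defined symmetric operator `A` of a Hilbert space and
non-real `μ`. -/
lemma LinearMap.IsSymmetric.exists_smul_sub_eq {E : Type*} [NormedAddCommGroup E]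
    [InnerProductSpace ℂ E] [CompleteSpace E] {A : E →ₗ[ℂ] E} (hA : A.IsSymmetric) {μ : ℂ}
    (hμ : μ.im ≠ 0) (h : E) : ∃ c, μ • c - A c = h := by
  -- Continuity is the Hellinger–Toeplitz theorem.
  let B : E →L[ℂ] E := ⟨A, hA.continuous⟩
  have hB : IsSelfAdjoint B := ContinuousLinearMap.isSelfAdjoint_iff_isSymmetric.2 hA
  have hunit : IsUnit (algebraMap ℂ (E →L[ℂ] E) μ - B) := by
    by_contra hn
    have hs : μ ∈ spectrum ℂ B := hn
    exact hμ (hB.im_eq_zero_of_mem_spectrum hs)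
  obtain ⟨C, hC⟩ := hunit.exists_right_inv
  refine ⟨C h, ?_⟩
  change μ • C h - B (C h) = h
  simpa [Algebra.algebraMap_eq_smul_one] using congrArg (fun D => D h) hC

namespace CanonicalSymmetry

/-! ### Canonical components and the metric -/

section Decomposition

variable {H : Type*} [NormedAddCommGroup H] [InnerProductSpace ℂ H] (K : CanonicalSymmetry H)

lemma coe_Pplus (x : H) : (K.Pplus x : H) = (1 / 2 : ℂ) • (x + K.J x) := rfl

lemma coe_Pminus (x : H) : (K.Pminus x : H) = (1 / 2 : ℂ) • (x - K.J x) := rfl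

lemma Pplus_add_Pminus (x : H) : (K.Pplus x : H) + (K.Pminus x : H) = x := by
  rw [coe_Pplus, coe_Pminus]
  module

lemma J_coe_plus (a : K.Hplus) : K.J (a : H) = a := a.2

lemma J_coe_minus (a : K.Hminus) : K.J (a : H) = -a := a.2

@[simp] lemma Pplus_coe_plus (a : K.Hplus) : K.Pplus (a : H) = a := by
  apply Subtype.ext
  rw [coe_Pplus, J_coe_plus]
  module

@[simp] lemma Pminus_coe_minus (a : K.Hminus) : K.Pminus (a : H) = a := by
  apply Subtype.ext
  rw [coe_Pminus, J_coe_minus]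
  module

@[simp] lemma Pminus_coe_plus (a : K.Hplus) : K.Pminus (a : H) = 0 := by
  apply Subtype.ext
  rw [coe_Pminus, J_coe_plus]
  simp

@[simp] lemma Pplus_coe_minus (a : K.Hminus) : K.Pplus (a : H) = 0 := by
  apply Subtype.ext
  rw [coe_Pplus, J_coe_minus]
  simp

lemma ext_proj {x y : H} (hp : K.Pplus x = K.Pplus y) (hm : K.Pminus x = K.Pminus y) : x = y := by
  rw [← K.Pplus_add_Pminus x, ← K.Pplus_add_Pminus y, hp, hm]

lemma mem_Hplus_iff (x : H) : x ∈ K.Hplus ↔ K.Pminus x = 0 := by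
  refine ⟨fun h => K.Pminus_coe_plus ⟨x, h⟩, fun h => ?_⟩
  rw [← K.Pplus_add_Pminus x, h, Submodule.coe_zero, add_zero]
  exact (K.Pplus x).2

lemma mem_Hminus_iff (x : H) : x ∈ K.Hminus ↔ K.Pplus x = 0 := by
  refine ⟨fun h => K.Pplus_coe_minus ⟨x, h⟩, fun h => ?_⟩
  rw [← K.Pplus_add_Pminus x, h, Submodule.coe_zero, zero_add]
  exact (K.Pminus x).2

lemma form_apply (x y : H) : K.form x y = ⟪x, K.J y⟫_ℂ := rfl

lemma inner_plus_minus (a : K.Hplus) (b : K.Hminus) : ⟪(a : H), (b : H)⟫_ℂ = 0 := by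
  have h := K.symmetric a b
  rw [J_coe_plus, J_coe_minus, inner_neg_right] at h
  linear_combination (1 / 2 : ℂ) * h

lemma inner_minus_plus (b : K.Hminus) (a : K.Hplus) : ⟪(b : H), (a : H)⟫_ℂ = 0 := by
  rw [← inner_conj_symm, inner_plus_minus, map_zero]

/-- The indefinite metric in terms of the canonical components. -/
lemma form_eq (x y : H) :
    K.form x y = ⟪K.Pplus x, K.Pplus y⟫_ℂ - ⟪K.Pminus x, K.Pminus y⟫_ℂ := by
  conv_lhs => rw [form_apply, ← K.Pplus_add_Pminus x, ← K.Pplus_add_Pminus y]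
  rw [map_add, J_coe_plus, J_coe_minus, inner_add_left, inner_add_right, inner_add_right,
    inner_neg_right, inner_neg_right, inner_plus_minus, inner_minus_plus, Submodule.coe_inner,
    Submodule.coe_inner]
  ring

lemma formOn_Hplus (a b : K.Hplus) : K.formOn K.Hplus a b = ⟪a, b⟫_ℂ := by
  change K.form a b = _
  simp [form_eq]

lemma formOn_Hminus (a b : K.Hminus) : K.formOn K.Hminus a b = -⟪a, b⟫_ℂ := by
  change K.form a b = _
  simp [form_eq]

lemma re_form_self (x : H) : (K.form x x).re = ‖K.Pplus x‖ ^ 2 - ‖K.Pminus x‖ ^ 2 := by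
  rw [form_eq, inner_self_eq_norm_sq_to_K, inner_self_eq_norm_sq_to_K]
  norm_cast

lemma isClosed_Hminus : IsClosed (K.Hminus : Set H) :=
  isClosed_eq K.J.continuous continuous_neg

end Decomposition

/-! ### The relations in terms of pairs in `T` -/

section Membership

variable {H : Type*} [NormedAddCommGroup H] [InnerProductSpace ℂ H] (K : CanonicalSymmetry H)
  (T : LinRel H H) (μ : ℂ)

lemma mem_Llin_iff (x : H) :
    x ∈ K.Llin T μ ↔ ∃ y, (x, y) ∈ T ∧ K.Pminus y = μ • K.Pminus x := by
  constructor
  · rintro ⟨⟨p, q⟩, ⟨⟨y, hy, rfl : p = y - μ • q⟩, hp⟩, rfl⟩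
    refine ⟨y, hy, ?_⟩
    have h := (K.mem_Hplus_iff _).1 hp
    simpa [sub_eq_zero] using h
  · rintro ⟨y, hy, h⟩
    refine ⟨(y - μ • x, x), ⟨⟨y, hy, rfl⟩, ?_⟩, rfl⟩
    refine (K.mem_Hplus_iff _).2 ?_
    simp [h]

lemma mem_gam_iff (s : K.Hplus) (b : K.Hminus) :
    (s, b) ∈ K.gam T μ ↔
      ∃ x y, (x, y) ∈ T ∧ K.Pminus y = μ • K.Pminus x ∧ K.Pplus x = s ∧ K.Pminus x = b := by
  constructor
  · rintro ⟨x, ⟨h1, h2⟩, h3⟩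
    obtain ⟨y, hy, h⟩ := (K.mem_Llin_iff T μ x).1 h2
    exact ⟨x, y, hy, h, h1.symm, h3.symm⟩
  · rintro ⟨x, y, hy, h, h1, h2⟩
    exact ⟨x, ⟨h1.symm, (K.mem_Llin_iff T μ x).2 ⟨y, hy, h⟩⟩, h2.symm⟩

lemma mem_Tplus_iff (s t : K.Hplus) :
    (s, t) ∈ K.Tplus T μ ↔
      ∃ x y, (x, y) ∈ T ∧ K.Pminus y = μ • K.Pminus x ∧ K.Pplus x = s ∧ K.Pplus y = t := by
  constructor
  · rintro ⟨⟨x, y⟩, ⟨hT, h⟩, he⟩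
    have h := (K.mem_Hplus_iff _).1 h
    obtain ⟨h1, h2⟩ := Prod.ext_iff.1 he
    exact ⟨x, y, hT, by simpa [sub_eq_zero] using h, h1, h2⟩
  · rintro ⟨x, y, hT, h, rfl, rfl⟩
    exact ⟨(x, y), ⟨hT, (K.mem_Hplus_iff _).2 (by simp [h])⟩, rfl⟩

lemma mem_Tminus_iff (s t : K.Hminus) :
    (s, t) ∈ K.Tminus T μ ↔
      ∃ x y, (x, y) ∈ T ∧ K.Pplus y = μ • K.Pplus x ∧ K.Pminus x = s ∧ K.Pminus y = t := by
  constructor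
  · rintro ⟨⟨x, y⟩, ⟨hT, h⟩, he⟩
    have h := (K.mem_Hminus_iff _).1 h
    obtain ⟨h1, h2⟩ := Prod.ext_iff.1 he
    exact ⟨x, y, hT, by simpa [sub_eq_zero] using h, h1, h2⟩
  · rintro ⟨x, y, hT, h, rfl, rfl⟩
    exact ⟨(x, y), ⟨hT, (K.mem_Hminus_iff _).2 (by simp [h])⟩, rfl⟩

lemma mem_Tmm_iff (s t : K.Hminus) :
    (s, t) ∈ K.Tmm T ↔ ∃ y, ((s : H), y) ∈ T ∧ K.Pminus y = t := by
  constructor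
  · rintro ⟨y, ⟨z, rfl : z = (s : H), h2⟩, h3⟩
    exact ⟨y, h2, h3.symm⟩
  · rintro ⟨y, h, rfl⟩
    exact ⟨y, ⟨(s : H), rfl, h⟩, rfl⟩

end Membership

/-! ### Consequences of self-adjointness -/

section SelfAdjoint

variable {H : Type*} [NormedAddCommGroup H] [InnerProductSpace ℂ H] {K : CanonicalSymmetry H}
  {T : LinRel H H}

lemma IsSelfAdj.mem_iff (hT : K.IsSelfAdj T) (u v : H) :
    (u, v) ∈ T ↔ ∀ x y, (x, y) ∈ T → K.form x v = K.form y u := by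
  conv_lhs => rw [hT]
  rfl

lemma IsSelfAdj.inner_sub_inner (hT : K.IsSelfAdj T) {x y u v : H} (h : (x, y) ∈ T)
    (h' : (u, v) ∈ T) :
    ⟪K.Pplus x, K.Pplus v⟫_ℂ - ⟪K.Pminus x, K.Pminus v⟫_ℂ =
      ⟪K.Pplus y, K.Pplus u⟫_ℂ - ⟪K.Pminus y, K.Pminus u⟫_ℂ := by
  rw [← form_eq, ← form_eq]
  exact (hT.mem_iff u v).1 h' x y h

lemma exists_mem_of_minus (hdom : K.Hminus ≤ T.dom) (u : K.Hminus) : ∃ v, ((u : H), v) ∈ T := by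
  obtain ⟨⟨x, y⟩, h, hx : x = (u : H)⟩ := hdom u.2
  exact ⟨y, hx ▸ h⟩

/-- On `H⁻`, the `H⁻`-component of a self-adjoint relation is symmetric. -/
lemma IsSelfAdj.inner_minus (hT : K.IsSelfAdj T) {a b : K.Hminus} {y v : H}
    (h : ((a : H), y) ∈ T) (h' : ((b : H), v) ∈ T) :
    ⟪a, K.Pminus v⟫_ℂ = ⟪K.Pminus y, b⟫_ℂ := by
  simpa using hT.inner_sub_inner h h'

/-- A vector `a ∈ H⁻` with `P⁻ T a - μ a = z` satisfies `|Im μ| ‖a‖ ≤ ‖z‖`. -/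
lemma IsSelfAdj.norm_minus_le (hT : K.IsSelfAdj T) {μ : ℂ} {a z : K.Hminus} {y : H}
    (h : ((a : H), y) ∈ T) (hz : K.Pminus y = μ • a + z) : |μ.im| * ‖a‖ ≤ ‖z‖ := by
  have h1 := hT.inner_minus h h
  rw [hz, inner_add_right, inner_add_left, inner_smul_right, inner_smul_left,
    inner_self_eq_norm_sq_to_K, ← inner_conj_symm z a] at h1
  have h2 := congrArg Complex.im h1
  -- Symmetry makes `⟪a, μ a + z⟫` real; this is its imaginary part.
  have h3 : μ.im * ‖a‖ ^ 2 = -(⟪a, z⟫_ℂ).im := by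
    have e : (((‖a‖ : ℝ) : ℂ) ^ 2) = ((‖a‖ ^ 2 : ℝ) : ℂ) := by push_cast; rfl
    simp only [Complex.coe_algebraMap, e, Complex.add_im, Complex.mul_im, Complex.conj_im,
      Complex.conj_re, Complex.ofReal_im, Complex.ofReal_re] at h2
    linarith
  have h4 : |μ.im| * ‖a‖ ^ 2 ≤ ‖a‖ * ‖z‖ := by
    calc |μ.im| * ‖a‖ ^ 2 = |μ.im * ‖a‖ ^ 2| := by rw [abs_mul, abs_of_nonneg (sq_nonneg ‖a‖)]
      _ = |(⟪a, z⟫_ℂ).im| := by rw [h3, abs_neg]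
      _ ≤ ‖⟪a, z⟫_ℂ‖ := Complex.abs_im_le_norm _
      _ ≤ ‖a‖ * ‖z‖ := norm_inner_le_norm a z
  rcases (norm_nonneg a).eq_or_lt with h0 | h0
  · rw [← h0, mul_zero]
    exact norm_nonneg z
  · refine le_of_mul_le_mul_left ?_ h0
    linarith

lemma IsSelfAdj.eq_zero_of_minus (hT : K.IsSelfAdj T) {μ : ℂ} (hμ : μ.im ≠ 0) {a : K.Hminus}
    {y : H} (h : ((a : H), y) ∈ T) (hy : K.Pminus y = μ • a) : a = 0 := by
  have h1 := hT.norm_minus_le h (z := 0) (by rw [hy, add_zero])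
  rw [norm_zero] at h1
  have h2 := abs_pos.2 hμ
  have := norm_nonneg a
  exact norm_eq_zero.1 (by nlinarith)

/-- Elements of `(T - μ I)⁻¹(H⁺)` are determined by their `H⁺`-component. -/
lemma IsSelfAdj.Pminus_eq (hT : K.IsSelfAdj T) {μ : ℂ} (hμ : μ.im ≠ 0) {x y x' y' : H}
    (h : (x, y) ∈ T) (hy : K.Pminus y = μ • K.Pminus x) (h' : (x', y') ∈ T)
    (hy' : K.Pminus y' = μ • K.Pminus x') (hx : K.Pplus x = K.Pplus x') :
    K.Pminus x = K.Pminus x' := by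
  have e : x - x' = (K.Pminus x - K.Pminus x' : K.Hminus) := by
    apply K.ext_proj
    · simp [hx]
    · simp
  have hs : (((K.Pminus x - K.Pminus x' : K.Hminus) : H), y - y') ∈ T := by
    rw [← e]
    exact T.sub_mem h h'
  exact sub_eq_zero.1 (hT.eq_zero_of_minus hμ hs (by rw [map_sub, hy, hy', smul_sub]))

/-- `P⁻ T` is single-valued when the domain of `T` contains `H⁻`. -/
lemma IsSelfAdj.Pminus_eq_zero (hT : K.IsSelfAdj T) (hdom : K.Hminus ≤ T.dom) {y : H}
    (h : ((0 : H), y) ∈ T) : K.Pminus y = 0 := by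
  -- Pairing `(0, y)` with a pair over `P⁻ y` leaves `‖P⁻ y‖² = 0`.
  obtain ⟨v, hv⟩ := exists_mem_of_minus hdom (K.Pminus y)
  have h1 := hT.inner_sub_inner h hv
  simpa using h1

/-- `T⁻⁻` as an everywhere defined linear map. -/
lemma IsSelfAdj.exists_linearMap (hT : K.IsSelfAdj T) (hdom : K.Hminus ≤ T.dom) :
    ∃ A : K.Hminus →ₗ[ℂ] K.Hminus, ∀ (a : K.Hminus) (y : H), ((a : H), y) ∈ T →
      K.Pminus y = A a := by
  choose f hf using exists_mem_of_minus hdom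
  have key : ∀ (a : K.Hminus) (y : H), ((a : H), y) ∈ T → K.Pminus y = K.Pminus (f a) := by
    intro a y h
    have h1 := T.sub_mem h (hf a)
    rw [Prod.mk_sub_mk, sub_self] at h1
    have h2 := hT.Pminus_eq_zero hdom h1
    rwa [map_sub, sub_eq_zero] at h2
  refine ⟨⟨⟨fun a => K.Pminus (f a), fun a b => ?_⟩, fun c a => ?_⟩, key⟩
  · rw [← map_add]
    exact (key _ _ (T.add_mem (hf a) (hf b))).symm
  · rw [← map_smul]
    exact (key _ _ (T.smul_mem c (hf a))).symm

variable [CompleteSpace H]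

/-- `T⁻⁻ - μ I⁻` is onto for non-real `μ`. -/
lemma IsSelfAdj.exists_minus (hT : K.IsSelfAdj T) (hdom : K.Hminus ≤ T.dom) {μ : ℂ}
    (hμ : μ.im ≠ 0) (h : K.Hminus) :
    ∃ (u : K.Hminus) (y : H), ((u : H), y) ∈ T ∧ K.Pminus y = μ • u + h := by
  obtain ⟨A, hA⟩ := hT.exists_linearMap hdom
  have : CompleteSpace K.Hminus := K.isClosed_Hminus.completeSpace_coe
  have hsymm : A.IsSymmetric := by
    intro a b
    obtain ⟨y, hy⟩ := exists_mem_of_minus hdom a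
    obtain ⟨v, hv⟩ := exists_mem_of_minus hdom b
    rw [← hA a y hy, ← hA b v hv]
    exact (hT.inner_minus hy hv).symm
  obtain ⟨c, hc⟩ := hsymm.exists_smul_sub_eq hμ h
  obtain ⟨y, hy⟩ := exists_mem_of_minus hdom (-c)
  refine ⟨-c, y, hy, ?_⟩
  rw [hA _ _ hy, map_neg, ← hc]
  module

/-- `P⁻ T` is bounded on the domain of `T` (Banach–Steinhaus). -/
lemma IsSelfAdj.exists_Pminus_bound (hT : K.IsSelfAdj T) (hdom : K.Hminus ≤ T.dom) :
    ∃ C : ℝ, ∀ x y, (x, y) ∈ T → ‖K.Pminus y‖ ≤ C * ‖x‖ := by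
  have : CompleteSpace K.Hminus := K.isClosed_Hminus.completeSpace_coe
  -- The functionals `⟪P⁻ y, ·⟫` over pairs with `‖x‖ ≤ 1`. At `u`, with `(u, v) ∈ T`,
  -- self-adjointness turns the value into `-[x, v]`, bounded by `‖J v‖`.
  let g : {p : T // ‖p.1.1‖ ≤ 1} → K.Hminus →L[ℂ] ℂ := fun p => innerSL ℂ (K.Pminus p.1.1.2)
  obtain ⟨C, hC⟩ := banach_steinhaus (g := g) (by
    intro u
    obtain ⟨v, hv⟩ := exists_mem_of_minus hdom u
    refine ⟨‖K.J v‖, ?_⟩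
    rintro ⟨⟨⟨x, y⟩, hxy⟩, hx⟩
    have h1 := (hT.mem_iff _ v).1 hv x y hxy
    rw [form_apply, form_eq, Pplus_coe_minus, Pminus_coe_minus, inner_zero_right, zero_sub] at h1
    change ‖⟪K.Pminus y, u⟫_ℂ‖ ≤ _
    rw [← norm_neg, ← h1]
    refine (norm_inner_le_norm _ _).trans ?_
    exact mul_le_of_le_one_left (norm_nonneg _) hx)
  refine ⟨C, fun x y hxy => ?_⟩
  have bound : ∀ x y, (x, y) ∈ T → ‖x‖ ≤ 1 → ‖K.Pminus y‖ ≤ C := fun x y h hx => by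
    simpa [g] using hC ⟨⟨(x, y), h⟩, hx⟩
  rcases eq_or_ne x 0 with rfl | hx
  · rw [hT.Pminus_eq_zero hdom hxy]
    simp
  · have hpos := norm_pos_iff.2 hx
    have h1 := bound _ _ (T.smul_mem ((‖x‖⁻¹ : ℝ) : ℂ) hxy) (by simp [norm_smul, hx])
    rw [map_smul, norm_smul, Complex.norm_real, norm_inv, norm_norm, inv_mul_le_iff₀ hpos] at h1
    linarith

/-- Removing an `H⁻`-component does not leave `D_T`; conversely, surjectivity of `T⁻⁻ - μ` supplies
the `H⁻`-component to add to `s`. -/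
lemma IsSelfAdj.mem_dom_gam_iff (hT : K.IsSelfAdj T) (hdom : K.Hminus ≤ T.dom) {μ : ℂ}
    (hμ : μ.im ≠ 0) (s : K.Hplus) : s ∈ (K.gam T μ).dom ↔ (s : H) ∈ T.dom := by
  constructor
  · rintro ⟨⟨s, b⟩, h, rfl⟩
    obtain ⟨x, y, hxy, -, rfl, -⟩ := (K.mem_gam_iff T μ s b).1 h
    have e : (K.Pplus x : H) = x - K.Pminus x := eq_sub_of_add_eq (K.Pplus_add_Pminus x)
    change (K.Pplus x : H) ∈ T.dom
    rw [e]
    exact Submodule.sub_mem _ ⟨(x, y), hxy, rfl⟩ (hdom (K.Pminus x).2)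
  · rintro ⟨⟨x, y⟩, hxy, rfl : x = (s : H)⟩
    obtain ⟨u, v, huv, hv⟩ := hT.exists_minus hdom hμ (-K.Pminus y)
    refine ⟨(s, u), (K.mem_gam_iff T μ s u).2 ⟨s + u, y + v, T.add_mem hxy huv, ?_, ?_, ?_⟩, rfl⟩
    · simp [hv]
    · simp
    · simp

lemma IsSelfAdj.gam_isBounded (hT : K.IsSelfAdj T) (hdom : K.Hminus ≤ T.dom) {μ : ℂ}
    (hμ : μ.im ≠ 0) : (K.gam T μ).IsBounded := by
  obtain ⟨C, hC⟩ := hT.exists_Pminus_bound hdom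
  refine ⟨C / |μ.im|, fun s b hsb => ?_⟩
  obtain ⟨x, y, hxy, hy, rfl, rfl⟩ := (K.mem_gam_iff T μ s b).1 hsb
  -- A second pair in `T`, now over `P⁺ x`. The difference lies over `P⁻ x ∈ H⁻` and solves the
  -- equation for `T⁻⁻ - μ` with right-hand side `-P⁻ w`.
  obtain ⟨⟨z, w⟩, hzw, rfl : z = _⟩ := (hT.mem_dom_gam_iff hdom hμ _).1 ⟨_, hsb, rfl⟩
  have e : x - K.Pplus x = (K.Pminus x : H) :=
    sub_eq_of_eq_add' (K.Pplus_add_Pminus x).symm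
  have h1 := T.sub_mem hxy hzw
  rw [Prod.mk_sub_mk] at h1
  change (x - (K.Pplus x : H), y - w) ∈ T at h1
  rw [e] at h1
  have h2 := hT.norm_minus_le (μ := μ) (z := -K.Pminus w) h1 (by rw [map_sub, hy, sub_eq_add_neg])
  rw [norm_neg] at h2
  have h3 := hC _ _ hzw
  rw [div_mul_eq_mul_div, le_div_iff₀ (abs_pos.2 hμ), mul_comm]
  exact h2.trans h3

/-- The pairs `(P⁻ y - μ̄ u, -P⁺ y)` with `(u, y) ∈ T`, `u ∈ H⁻` make up the adjoint of
`γ_μ`. -/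
lemma IsSelfAdj.mem_adjPM_gam_iff (hT : K.IsSelfAdj T) (hdom : K.Hminus ≤ T.dom) {μ : ℂ}
    (hμ : μ.im ≠ 0) (h : K.Hminus) (w : K.Hplus) :
    (h, w) ∈ K.adjPM (K.gam T μ) ↔ ∃ (u : K.Hminus) (y : H),
      ((u : H), y) ∈ T ∧ K.Pminus y = conj μ • u + h ∧ K.Pplus y = -w := by
  -- With `conj μ` here, `⟪b, μ̄ u⟫` and `⟪μ b, u⟫` cancel in the symmetry identity.
  have pairing : ∀ (u : K.Hminus) (v : H), ((u : H), v) ∈ T → K.Pminus v = conj μ • u + h →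
      ∀ s b, (s, b) ∈ K.gam T μ → ⟪s, K.Pplus v⟫_ℂ = ⟪b, h⟫_ℂ := by
    intro u v huv hv s b hsb
    obtain ⟨x, y, hxy, hy, rfl, rfl⟩ := (K.mem_gam_iff T μ s b).1 hsb
    have h1 := hT.inner_sub_inner hxy huv
    rw [hv, hy, Pplus_coe_minus, Pminus_coe_minus, inner_zero_right, inner_add_right,
      inner_smul_right, inner_smul_left] at h1
    linear_combination h1
  have mem_adj : (h, w) ∈ K.adjPM (K.gam T μ) ↔
      ∀ s b, (s, b) ∈ K.gam T μ → ⟪s, w⟫_ℂ = -⟪b, h⟫_ℂ := by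
    simp only [← formOn_Hplus, ← formOn_Hminus]
    rfl
  rw [mem_adj]
  constructor
  · intro hw
    obtain ⟨u, v, huv, hv⟩ := hT.exists_minus hdom (μ := conj μ) (by simpa using hμ) h
    -- Two adjoint values at `h` differ by a vector orthogonal to `D_γ`, the domain of `T` in `H⁺`.
    -- Such a vector lies in the multivalued part of `T`; this needs `Tᶜ ⊆ T`, not just symmetry.
    have h0 : ((0 : H), ((K.Pplus v + w : K.Hplus) : H)) ∈ T := by
      rw [hT.mem_iff]
      intro x y hxy
      rw [form_eq, Pplus_coe_plus, Pminus_coe_plus, map_zero, inner_zero_right, sub_zero]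
      have hx : K.Pplus x ∈ (K.gam T μ).dom := by
        rw [hT.mem_dom_gam_iff hdom hμ,
          show (K.Pplus x : H) = x - K.Pminus x from eq_sub_of_add_eq (K.Pplus_add_Pminus x)]
        exact Submodule.sub_mem _ ⟨(x, y), hxy, rfl⟩ (hdom (K.Pminus x).2)
      obtain ⟨⟨s, b⟩, hsb, hs : s = _⟩ := hx
      rw [← hs, inner_add_right, pairing u v huv hv s b hsb, hw s b hsb]
      ring
    refine ⟨u, v - (K.Pplus v + w : K.Hplus), ?_, ?_, ?_⟩
    · simpa using T.sub_mem huv h0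
    · rw [map_sub, Pminus_coe_plus, sub_zero, hv]
    · rw [map_sub, Pplus_coe_plus]
      abel_nf
  · rintro ⟨u, v, huv, hv, hw⟩ s b hsb
    rw [← pairing u v huv hv s b hsb, hw, inner_neg_right, neg_neg]

/-- The Schur-type resolvent formula for `(𝒯⁻(μ) - μ I⁻)⁻¹`. -/
lemma IsSelfAdj.Tminus_resolvent (hT : K.IsSelfAdj T) (hdom : K.Hminus ≤ T.dom) {μ : ℂ}
    (hμ : μ.im ≠ 0) :
    ((K.Tminus T μ).subSmulId μ).inv =
      LinRel.opSum ((K.Tmm T).subSmulId μ).inv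
        (LinRel.comp (K.gam T μ)
          (LinRel.comp ((K.Tplus T μ).subSmulId μ).inv (K.adjPM (K.gam T (conj μ))))) := by
  have hμ' : (conj μ).im ≠ 0 := by simpa using hμ
  ext ⟨h, k⟩
  constructor
  · rintro ⟨z, hz, rfl : h = z - μ • k⟩
    obtain ⟨x, y, hxy, hy, rfl, rfl⟩ := (K.mem_Tminus_iff T μ k z).1 hz
    -- `u` is `(T⁻⁻ - μ)⁻¹` of the given vector, so the remainder satisfies `hsub'`.
    obtain ⟨u, v, huv, hv⟩ := hT.exists_minus hdom hμ (K.Pminus y - μ • K.Pminus x)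
    have hsub : (x - u, y - v) ∈ T := T.sub_mem hxy huv
    have hsub' : K.Pminus (y - v) = μ • K.Pminus (x - u) := by
      rw [map_sub, map_sub, hv, Pminus_coe_minus, smul_sub]
      abel_nf
    refine ⟨u, K.Pminus (x - u), ⟨K.Pminus v, (K.mem_Tmm_iff T _ _).2 ⟨v, huv, rfl⟩, ?_⟩,
      ⟨K.Pplus (x - u), ⟨-K.Pplus v, ?_, ⟨K.Pplus (y - v), ?_, ?_⟩⟩, ?_⟩, ?_⟩
    · change K.Pminus y - μ • K.Pminus x = K.Pminus v - μ • u
      rw [hv]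
      abel_nf
    · refine (hT.mem_adjPM_gam_iff hdom hμ' _ _).2 ⟨u, v, huv, ?_, ?_⟩
      · rw [Complex.conj_conj, hv]
      · rw [neg_neg]
    · exact (K.mem_Tplus_iff T μ _ _).2 ⟨_, _, hsub, hsub', rfl, rfl⟩
    · change -K.Pplus v = K.Pplus (y - v) - μ • K.Pplus (x - u)
      rw [map_sub, map_sub, hy, Pplus_coe_minus, sub_zero]
      abel_nf
    · exact (K.mem_gam_iff T μ _ _).2 ⟨_, _, hsub, hsub', rfl, rfl⟩
    · change K.Pminus x = u + K.Pminus (x - u)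
      rw [map_sub, Pminus_coe_minus]
      abel_nf
  · rintro ⟨a, b, ⟨z, hz, rfl : h = z - μ • a⟩, ⟨s, ⟨w, hw, ⟨t, ht, rfl : w = t - μ • s⟩⟩, hsb⟩,
      rfl : k = a + b⟩
    obtain ⟨c, hc, rfl⟩ := (K.mem_Tmm_iff T _ _).1 hz
    obtain ⟨u, v, huv, hv, hv'⟩ := (hT.mem_adjPM_gam_iff hdom hμ' _ _).1 hw
    obtain ⟨x, y, hxy, hy, rfl, rfl⟩ := (K.mem_Tplus_iff T μ _ _).1 ht
    obtain ⟨x', y', hxy', hy', hs, rfl⟩ := (K.mem_gam_iff T μ _ _).1 hsb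
    -- The pairs behind `𝒯⁺(μ)` and `γ` may differ, but share their `H⁻`-component.
    have hb := hT.Pminus_eq hμ hxy' hy' hxy hy hs
    rw [Complex.conj_conj] at hv
    -- Both `u` and `a` solve the equation for `T⁻⁻ - μ` with the same right-hand side.
    have hua : u - a = 0 := by
      refine hT.eq_zero_of_minus hμ (y := v - c) (by simpa using T.sub_mem huv hc) ?_
      rw [map_sub, hv, smul_sub]
      change μ • u + (K.Pminus c - μ • a) - K.Pminus c = _
      abel_nf
    obtain rfl : u = a := sub_eq_zero.1 hua
    refine ⟨μ • K.Pminus x + K.Pminus v, (K.mem_Tminus_iff T μ _ _).2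
      ⟨x + u, y + v, T.add_mem hxy huv, ?_, ?_, ?_⟩, ?_⟩
    · rw [map_add, map_add, hv', Pplus_coe_minus, add_zero]
      abel_nf
    · rw [map_add, Pminus_coe_minus, hb, add_comm]
    · rw [map_add, hy]
    · change K.Pminus c - μ • u = μ • K.Pminus x + K.Pminus v - μ • (u + K.Pminus x')
      rw [hv, hb, smul_add]
      abel_nf

end SelfAdjoint

end CanonicalSymmetry

/-! ### Bounded relations are closable operators -/

namespace LinRel

variable {E F : Type*} [NormedAddCommGroup E] [InnerProductSpace ℂ E]
  [NormedAddCommGroup F] [InnerProductSpace ℂ F]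

lemma IsBounded.isOperator {R : LinRel E F} (hR : R.IsBounded) : R.IsOperator := by
  obtain ⟨C, hC⟩ := hR
  refine (Submodule.eq_bot_iff _).2 fun y hy => norm_le_zero_iff.1 ?_
  simpa using hC 0 y hy

/-- The norm inequality is a closed condition on pairs, so the same constant works. -/
lemma IsBounded.topologicalClosure {R : LinRel E F} (hR : R.IsBounded) :
    IsBounded (Submodule.topologicalClosure R) := by
  obtain ⟨C, hC⟩ := hR
  refine ⟨C, fun x y hxy => ?_⟩
  have hcl : IsClosed {p : E × F | ‖p.2‖ ≤ C * ‖p.1‖} :=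
    isClosed_le (by fun_prop) (by fun_prop)
  exact closure_minimal (fun p hp => hC p.1 p.2 hp) hcl hxy

lemma IsBounded.isClosable {R : LinRel E F} (hR : R.IsBounded) : R.IsClosable :=
  hR.topologicalClosure.isOperator

end LinRel

/-! ### The main theorem -/

theorem proposition7p2 {H : Type*} [NormedAddCommGroup H] [InnerProductSpace ℂ H]
    [CompleteSpace H] (K : CanonicalSymmetry H) (T : LinRel H H)
    (hT : K.IsSelfAdj T) (hdom : K.Hminus ≤ T.dom) (μ : ℂ) (hμ : μ.im ≠ 0) :
    (K.ClassAPlus (K.Llin T μ) ∧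
      (K.gam T μ).IsOperator ∧
      (K.gam T μ).IsClosable ∧
      (K.gam T μ).dom = (K.Llin T μ).map K.Pplus ∧
      (K.gam T μ).dom = T.dom.comap K.Hplus.subtype ∧
      (K.gam T μ).dom = (K.Tplus T μ).dom ∧
      (K.adjPM (K.gam T μ)).dom = ⊤ ∧
      (K.gam T μ).IsBounded ∧
      ((K.gam T μ).IsContraction ↔ K.IsNonneg (K.Llin T μ))) ∧
    ((K.Tminus T μ).subSmulId μ).inv =
      LinRel.opSum ((K.Tmm T).subSmulId μ).inv
        (LinRel.comp (K.gam T μ)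
          (LinRel.comp ((K.Tplus T μ).subSmulId μ).inv (K.adjPM (K.gam T (conj μ))))) := by

  have hbdd := hT.gam_isBounded hdom hμ
  have hdom_map : (K.gam T μ).dom = (K.Llin T μ).map K.Pplus := by
    ext s
    constructor
    · rintro ⟨⟨s, b⟩, h, rfl⟩
      obtain ⟨x, y, hxy, hy, rfl, rfl⟩ := (K.mem_gam_iff T μ s b).1 h
      exact ⟨x, (K.mem_Llin_iff T μ x).2 ⟨y, hxy, hy⟩, rfl⟩
    · rintro ⟨x, hx, rfl⟩
      obtain ⟨y, hxy, hy⟩ := (K.mem_Llin_iff T μ x).1 hx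
      exact ⟨(_, _), (K.mem_gam_iff T μ _ _).2 ⟨x, y, hxy, hy, rfl, rfl⟩, rfl⟩
  refine ⟨⟨?_, hbdd.isOperator, hbdd.isClosable, hdom_map, ?_, ?_, ?_, hbdd, ?_⟩,
    hT.Tminus_resolvent hdom hμ⟩
  · refine (Submodule.eq_bot_iff _).2 ?_
    rintro x ⟨hx, hL⟩
    obtain ⟨y, hxy, hy⟩ := (K.mem_Llin_iff T μ x).1 hL
    lift x to K.Hminus using hx
    rw [K.Pminus_coe_minus] at hy
    rw [hT.eq_zero_of_minus hμ hxy hy, Submodule.coe_zero]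
  · ext s
    exact hT.mem_dom_gam_iff hdom hμ s
  · ext s
    constructor
    · rintro ⟨⟨s, b⟩, h, rfl⟩
      obtain ⟨x, y, hxy, hy, hs, -⟩ := (K.mem_gam_iff T μ s b).1 h
      exact ⟨(s, K.Pplus y), (K.mem_Tplus_iff T μ _ _).2 ⟨x, y, hxy, hy, hs, rfl⟩, rfl⟩
    · rintro ⟨⟨s, t⟩, h, rfl⟩
      obtain ⟨x, y, hxy, hy, hs, -⟩ := (K.mem_Tplus_iff T μ s t).1 h
      exact ⟨(s, K.Pminus x), (K.mem_gam_iff T μ _ _).2 ⟨x, y, hxy, hy, hs, rfl⟩, rfl⟩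
  · refine (Submodule.eq_top_iff').2 fun h => ?_
    obtain ⟨u, v, huv, hv⟩ := hT.exists_minus hdom (μ := conj μ) (by simpa using hμ) h
    exact ⟨(h, -K.Pplus v), (hT.mem_adjPM_gam_iff hdom hμ _ _).2
      ⟨u, v, huv, hv, (neg_neg _).symm⟩, rfl⟩
  · constructor
    · intro hc x hx
      obtain ⟨y, hxy, hy⟩ := (K.mem_Llin_iff T μ x).1 hx
      have h := hc _ _ ((K.mem_gam_iff T μ _ _).2 ⟨x, y, hxy, hy, rfl, rfl⟩)
      rw [K.re_form_self, sub_nonneg]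
      exact pow_le_pow_left₀ (norm_nonneg _) h 2
    · intro hn s b hsb
      obtain ⟨x, y, hxy, hy, rfl, rfl⟩ := (K.mem_gam_iff T μ s b).1 hsb
      have h := hn x ((K.mem_Llin_iff T μ x).2 ⟨y, hxy, hy⟩)
      rw [K.re_form_self, sub_nonneg] at h
      exact le_of_sq_le_sq h (norm_nonneg _)
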